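/- Let $\mathcal C$ be a Grothendieck category having a projective generator. For a monad $(U,\theta,\eta)$ on $\mathcal C$ let $EM_U$ be its Eilenberg-Moore category, with objects pairs $(M, f_M : UM\to M)$. A morphism of monads $\phi:U\to U'$ on $\mathcal C$ induces the restriction functor $\phi_*:EM_{U'}\to EM_U$, $(N,f_N)\mapsto (N,f_N\circ\phi_N)$. When $U'$ preserves colimits, $\phi_*$ has the left adjoint $\phi^*:EM_U\to EM_{U'}$ that sends $(M,f_M)$ to the coequalizer in $EM_{U'}$ of $\theta'_M\circ U'\phi_M$ and $U'f_M : U'UM\rightrightarrows U'M$. Let $\mathbb Q$ be a (small) partially ordered set, regarded as a category with an arrow $x\to y$ whenever $x\le y$, and let $\mathscr U:\mathbb Q\to Mnd(\mathcal C)$ be a functor to the category of monads on $\mathcal C$ such that each $\mathscr U_x$ is exact and preserves colimits. Suppose that $\mathscr U$ is flat, i.e. for each arrow $\phi:x\to y$ of $\mathbb Q$ the functor $\phi^*=\mathscr U(\phi)^*:EM_{\mathscr U_x}\to EM_{\mathscr U_y}$ is exact. Let $Mod\text{-}\mathscr U$ be the category of $\mathscr U$-modules: a $\mathscr U$-module $\mathscr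 M$ consists of objects $\mathscr M_x\in EM_{\mathscr U_x}$ for $x\in\mathbb Q$ and morphisms $\mathscr M_\phi:\mathscr M_x\to\phi_*\mathscr M_y$ in $EM_{\mathscr U_x}$ for arrows $\phi:x\to y$, with $\mathscr M_{id_x}=id$ and $\phi_*(\mathscr M_\psi)\circ\mathscr M_\phi=\mathscr M_{\psi\phi}$ for composable $\phi,\psi$; a morphism $\xi:\mathscr M\to\mathscr M'$ is a family of morphisms $\xi_x:\mathscr M_x\to\mathscr M'_x$ in $EM_{\mathscr U_x}$ with $\mathscr M'_\phi\circ\xi_x=\phi_*(\xi_y)\circ\mathscr M_\phi$. Let $Cart\text{-}\mathscr U$ be the full subcategory of those $\mathscr M$ for which the adjoint morphism $\mathscr M^\phi:\phi^*\mathscr M_x\to\mathscr M_y$ is an isomorphism for every arrow $\phi:x\to y$. Then the inclusion functor $i:Cart\text{-}\mathscr U\to Mod\text{-}\mathscr U$ has a right adjoint. -/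

import Mathlib

open CategoryTheory CategoryTheory.Limits

universe v u w' w

namespace MonadQuiver

section ChangeOfMonad

variable {C : Type u} [Category.{v} C]

/-- Restriction along a morphism of monads `φ : T ⟶ T'`, i.e. the functor
`φ_* : EM_{T'} ⥤ EM_T`, `(N, f) ↦ (N, f ∘ φ_N)`, which does not change underlying morphisms. -/
abbrev restrict {T T' : Monad C} (φ : T ⟶ T') : T'.Algebra ⥤ T.Algebra :=
  Monad.algebraFunctorOfMonadHom φ

/-- For `h : X ⟶ N` in `C`, the composite `T' X ⟶ T' N ⟶ N` is a morphism of algebras. -/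
lemma lift_comm (T' : Monad C) (N : T'.Algebra) {X : C} (h : X ⟶ N.A) :
    T'.map (T'.map h ≫ N.a) ≫ N.a = T'.μ.app X ≫ T'.map h ≫ N.a := by
  have h1 : T'.map (T'.map h) ≫ T'.μ.app N.A = T'.μ.app X ≫ T'.map h :=
    Monad.mu_naturality _ T' h
  rw [Functor.map_comp, Category.assoc, ← N.assoc, reassoc_of% h1]

lemma lift_comp_of_comm (T' : Monad C) (N : T'.Algebra) {X : C} (k : T'.obj X ⟶ N.A)
    (hk : T'.map k ≫ N.a = T'.μ.app X ≫ k) : T'.map (T'.η.app X ≫ k) ≫ N.a = k := by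
  have h3 : T'.map (T'.η.app X) ≫ T'.μ.app X = 𝟙 (T'.obj X) := T'.right_unit X
  exact (congrArg (· ≫ N.a) (T'.map_comp (T'.η.app X) k)).trans
    ((Category.assoc _ _ _).trans ((congrArg (T'.map (T'.η.app X) ≫ ·) hk).trans
      ((Category.assoc _ _ _).symm.trans ((congrArg (· ≫ k) h3).trans (Category.id_comp k)))))

lemma restrict_comm {T T' : Monad C} (φ : T ⟶ T') (M : T.Algebra) (N : T'.Algebra)
    (k : T'.obj M.A ⟶ N.A) (hk : T'.map k ≫ N.a = T'.μ.app M.A ≫ k)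
    (h : (T'.map (φ.app M.A) ≫ T'.μ.app M.A) ≫ k = T'.map M.a ≫ k) :
    T.map (T'.η.app M.A ≫ k) ≫ φ.app N.A ≫ N.a = M.a ≫ T'.η.app M.A ≫ k := by
  have h5 : M.a ≫ T'.η.app M.A = T'.η.app (T.obj M.A) ≫ T'.map M.a :=
    Monad.unit_naturality _ T' M.a
  have h6 : φ.app M.A ≫ T'.η.app (T'.obj M.A) = T'.η.app (T.obj M.A) ≫ T'.map (φ.app M.A) :=
    Monad.unit_naturality _ T' (φ.app M.A)
  have h4 : T'.η.app (T'.obj M.A) ≫ T'.μ.app M.A = 𝟙 (T'.obj M.A) := T'.left_unit M.A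
  have h7 : T.map (T'.η.app M.A ≫ k) ≫ φ.app N.A = φ.app M.A ≫ T'.map (T'.η.app M.A ≫ k) :=
    φ.toNatTrans.naturality (T'.η.app M.A ≫ k)
  have h8 := lift_comp_of_comm T' N k hk
  rw [reassoc_of% h7, h8, reassoc_of% h5, ← h, Category.assoc, ← reassoc_of% h6, reassoc_of% h4]

lemma extend_comm {T T' : Monad C} (φ : T ⟶ T') (M : T.Algebra) (N : T'.Algebra)
    (h : M.A ⟶ N.A) (hh : T.map h ≫ φ.app N.A ≫ N.a = M.a ≫ h) :
    (T'.map (φ.app M.A) ≫ T'.μ.app M.A) ≫ T'.map h ≫ N.a = T'.map M.a ≫ T'.map h ≫ N.a := by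
  have h1 := lift_comm T' N h
  have h3 : T.map h ≫ φ.app N.A = φ.app M.A ≫ T'.map h := φ.toNatTrans.naturality h
  rw [Category.assoc, ← h1, ← Functor.map_comp_assoc, ← Functor.map_comp_assoc, ← hh,
    reassoc_of% h3]

/-- The morphism of free algebras `T' T M ⟶ T' M` given by `θ'_M ∘ T' φ_M`. -/
@[simps]
def extendTop {T T' : Monad C} (φ : T ⟶ T') (M : T.Algebra) :
    T'.free.obj (T.obj M.A) ⟶ T'.free.obj M.A where
  f := T'.map (φ.app M.A) ≫ T'.μ.app M.A
  h := lift_comm T' (T'.free.obj M.A) (φ.app M.A)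

/-- The morphism of free algebras `T' T M ⟶ T' M` given by `T' f_M`,
where `f_M : T M ⟶ M` is the structure morphism. -/
abbrev extendBot {T : Monad C} (T' : Monad C) (M : T.Algebra) :
    T'.free.obj (T.obj M.A) ⟶ T'.free.obj M.A :=
  T'.free.map M.a

variable [HasCoequalizers C]

instance hasCoequalizers_algebra (T' : Monad C)
    [PreservesColimitsOfShape WalkingParallelPair T'.toFunctor] :
    HasCoequalizers T'.Algebra :=
  ⟨fun D => Monad.forget_creates_colimits_of_monad_preserves D⟩

variable {T T' : Monad C} [PreservesColimitsOfShape WalkingParallelPair T'.toFunctor]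
  (φ : T ⟶ T')

/-- The object `φ^* M` of `EM_{T'}`: the coequalizer in `EM_{T'}` of the two morphisms
`T' T M ⇉ T' M` above. -/
noncomputable def extendObj (M : T.Algebra) : T'.Algebra :=
  coequalizer (extendTop φ M) (extendBot T' M)

/-- The quotient morphism `T' M ⟶ φ^* M`. -/
noncomputable def extendπ (M : T.Algebra) : T'.free.obj M.A ⟶ extendObj φ M :=
  coequalizer.π (extendTop φ M) (extendBot T' M)

lemma extendπ_condition (M : T.Algebra) :
    extendTop φ M ≫ extendπ φ M = extendBot T' M ≫ extendπ φ M :=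
  coequalizer.condition _ _

/-- The morphism `M ⟶ φ_* N` corresponding to `g : φ^* M ⟶ N`. -/
@[simps]
noncomputable def toRestrict {M : T.Algebra} {N : T'.Algebra} (g : extendObj φ M ⟶ N) :
    M ⟶ (restrict φ).obj N where
  f := T'.η.app M.A ≫ (extendπ φ M ≫ g).f
  h := by
    have h0 : extendTop φ M ≫ (extendπ φ M ≫ g) = extendBot T' M ≫ (extendπ φ M ≫ g) := by
      rw [← Category.assoc, extendπ_condition, Category.assoc]
    exact restrict_comm φ M N (extendπ φ M ≫ g).f (extendπ φ M ≫ g).h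
      (congrArg (fun k => Monad.Algebra.Hom.f k) h0)

/-- The morphism `φ^* M ⟶ N` corresponding to `h : M ⟶ φ_* N`, induced by the composite
`T' M ⟶ T' N ⟶ N`. -/
noncomputable def ofRestrict {M : T.Algebra} {N : T'.Algebra} (h : M ⟶ (restrict φ).obj N) :
    extendObj φ M ⟶ N :=
  coequalizer.desc (f := extendTop φ M) (g := extendBot T' M)
    { f := T'.map h.f ≫ N.a
      h := lift_comm T' N h.f }
    (Monad.Algebra.Hom.ext (extend_comm φ M N h.f h.h))

lemma extendπ_ofRestrict_f {M : T.Algebra} {N : T'.Algebra} (h : M ⟶ (restrict φ).obj N) :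
    (extendπ φ M ≫ ofRestrict φ h).f = T'.map h.f ≫ N.a :=
  congrArg (fun k => Monad.Algebra.Hom.f k) (coequalizer.π_desc
    (f := extendTop φ M) (g := extendBot T' M) _ _)

/-- The bijection `EM_{T'}(φ^* M, N) ≃ EM_T(M, φ_* N)`. -/
noncomputable def extendHomEquiv (M : T.Algebra) (N : T'.Algebra) :
    (extendObj φ M ⟶ N) ≃ (M ⟶ (restrict φ).obj N) where
  toFun g := toRestrict φ g
  invFun h := ofRestrict φ h
  left_inv g := by
    apply coequalizer.hom_ext (f := extendTop φ M) (g := extendBot T' M)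
    change extendπ φ M ≫ ofRestrict φ (toRestrict φ g) = extendπ φ M ≫ g
    apply Monad.Algebra.Hom.ext
    exact (extendπ_ofRestrict_f φ (toRestrict φ g)).trans
      (lift_comp_of_comm T' N (extendπ φ M ≫ g).f (extendπ φ M ≫ g).h)
  right_inv h := by
    apply Monad.Algebra.Hom.ext
    have h1 : h.f ≫ T'.η.app N.A = T'.η.app M.A ≫ T'.map h.f :=
      Monad.unit_naturality _ T' h.f
    exact (congrArg (T'.η.app M.A ≫ ·) (extendπ_ofRestrict_f φ h)).trans
      ((Category.assoc _ _ _).symm.trans ((congrArg (· ≫ N.a) h1.symm).trans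
        ((Category.assoc _ _ _).trans ((congrArg (h.f ≫ ·) N.unit).trans (Category.comp_id _)))))

/-- Extension along a morphism of monads `φ : T ⟶ T'`, i.e. the functor
`φ^* : EM_T ⥤ EM_{T'}`, given on objects by the coequalizer `extendObj`. -/
noncomputable def extend : T.Algebra ⥤ T'.Algebra :=
  Adjunction.leftAdjointOfEquiv (G := restrict φ) (extendHomEquiv φ) (by
    intro X Y Y' g h
    apply Monad.Algebra.Hom.ext
    change T'.η.app X.A ≫ (extendπ φ X ≫ h ≫ g).f = (T'.η.app X.A ≫ (extendπ φ X ≫ h).f) ≫ g.f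
    rw [← Category.assoc (extendπ φ X), Monad.Algebra.comp_f]
    exact (Category.assoc _ _ _).symm)

/-- The adjunction `φ^* ⊣ φ_*`. -/
noncomputable def extendRestrictAdjunction : extend φ ⊣ restrict φ :=
  Adjunction.adjunctionOfEquivLeft (G := restrict φ) (extendHomEquiv φ) _

/-- A morphism of monads `φ` is flat if the functor `φ^*` is exact. -/
def IsFlatHom : Prop :=
  exactFunctor T.Algebra T'.Algebra (extend φ)

end ChangeOfMonad

section Modules

variable {C : Type u} [Category.{v} C] {Q : Type w} [Category.{w'} Q]

/-- A module over a monad quiver `U : Q ⥤ Monad C`. Identities between morphisms of algebras are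
stated for the underlying morphisms of `C`, since `φ_*` does not change these. -/
structure Module (U : Q ⥤ Monad C) where
  /-- the `U_x`-algebra at the vertex `x` -/
  obj (x : Q) : (U.obj x).Algebra
  /-- the structure morphism `M_φ : M_x ⟶ φ_* M_y` -/
  map {x y : Q} (φ : x ⟶ y) : obj x ⟶ (restrict (U.map φ)).obj (obj y)
  map_id (x : Q) : (map (𝟙 x)).f = 𝟙 (obj x).A
  map_comp {x y z : Q} (φ : x ⟶ y) (ψ : y ⟶ z) : (map (φ ≫ ψ)).f = (map φ).f ≫ (map ψ).f

namespace Module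

variable {U : Q ⥤ Monad C}

/-- Morphisms of modules over a monad quiver. -/
@[ext]
structure Hom (M N : Module U) where
  /-- the component at the vertex `x` -/
  app (x : Q) : M.obj x ⟶ N.obj x
  naturality {x y : Q} (φ : x ⟶ y) :
    app x ≫ N.map φ = M.map φ ≫ (restrict (U.map φ)).map (app y)

/-- The category `Mod-U`. -/
instance : Category (Module U) where
  Hom M N := Hom M N
  id M :=
    { app := fun x => 𝟙 (M.obj x)
      naturality := fun φ => by simp }
  comp ξ ζ :=
    { app := fun x => ξ.app x ≫ ζ.app x
      naturality := fun φ => by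
        rw [Category.assoc, ζ.naturality, ← Category.assoc, ξ.naturality, Category.assoc,
          Functor.map_comp] }

variable [HasCoequalizers C]
  [∀ x, PreservesColimitsOfShape WalkingParallelPair (U.obj x).toFunctor]

/-- The morphism `M^φ : φ^* M_x ⟶ M_y` adjoint to `M_φ`. -/
noncomputable def extMap (M : Module U) {x y : Q} (φ : x ⟶ y) :
    (extend (U.map φ)).obj (M.obj x) ⟶ M.obj y :=
  ((extendRestrictAdjunction (U.map φ)).homEquiv (M.obj x) (M.obj y)).symm (M.map φ)

end Module

variable [HasCoequalizers C] (U : Q ⥤ Monad C)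
  [∀ x, PreservesColimitsOfShape WalkingParallelPair (U.obj x).toFunctor]

/-- A monad quiver is flat if all its transition morphisms are flat. -/
def IsFlat : Prop :=
  ∀ ⦃x y : Q⦄ (φ : x ⟶ y), IsFlatHom (U.map φ)

/-- A module `M` is cartesian if all morphisms `M^φ : φ^* M_x ⟶ M_y` are isomorphisms. -/
def isCartesian : ObjectProperty (Module U) :=
  fun M => ∀ ⦃x y : Q⦄ (φ : x ⟶ y), IsIso (M.extMap φ)

/-- The category `Cart-U`, the full subcategory of `Mod-U` on the cartesian modules. -/
abbrev Cart := (isCartesian U).FullSubcategory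

/-- The inclusion functor `Cart-U ⥤ Mod-U`. -/
abbrev cartInclusion : Cart U ⥤ Module U := (isCartesian U).ι

end Modules

end MonadQuiver

/-! By the special adjoint functor theorem it suffices that `Cart U` is cocomplete and
co-well-powered with a small separating family, and that the inclusion preserves colimits. Colimits
of modules are computed vertexwise, and `φ^*` is a left adjoint, so cartesian modules are closed
under them. A quotient of a cartesian module is determined by its underlying quotients in `C`, which
bounds the quotients.

For the separating family, let `G` be a separator of `C`, `N` cartesian and `γ : G ⟶ N_x`. Transport
of a subobject along `φ : x ⟶ y` is the image of `U_y S_x ⟶ U_y N_x ⟶ N_y`. A countable closure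
process (`exists_transition_eq`) puts `γ` in a family of `κ`-small subobjects with the transport of
`S_x` equal to `S_y` for every `φ`. Identity arrows make each `S_x` a subalgebra. Flatness makes
`φ^* S_x ⟶ S_y` mono and the equality makes it epi, so the family is a cartesian submodule
(`exists_submodule`). Such submodules form a small set up to isomorphism because `κ` does not depend
on `N`. -/

namespace MonadQuiver

/-! ### Vertexwise colimits of modules -/

section Evaluation

variable {C : Type u} [Category.{v} C] {Q : Type w} [Category.{w'} Q] {U : Q ⥤ Monad C}

namespace Module

lemma hom_ext {M N : Module U} {f g : M ⟶ N} (h : ∀ x, Hom.app f x = Hom.app g x) : f = g :=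
  Hom.ext (funext h)

/-- The morphism of `C` underlying `M_φ`. -/
def mapA (M : Module U) {x y : Q} (φ : x ⟶ y) : (M.obj x).A ⟶ (M.obj y).A :=
  (M.map φ).f

/-- The morphism of `C` underlying the component of a morphism of modules at `x`. -/
def appA {M N : Module U} (f : M ⟶ N) (x : Q) : (M.obj x).A ⟶ (N.obj x).A :=
  (Hom.app f x).f

lemma mapA_id (M : Module U) (x : Q) : M.mapA (𝟙 x) = 𝟙 (M.obj x).A := M.map_id x

lemma mapA_comp (M : Module U) {x y z : Q} (φ : x ⟶ y) (ψ : y ⟶ z) :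
    M.mapA (φ ≫ ψ) = M.mapA φ ≫ M.mapA ψ := M.map_comp φ ψ

lemma mapA_a (M : Module U) {x y : Q} (φ : x ⟶ y) :
    (U.obj x).map (M.mapA φ) ≫ (U.map φ).app (M.obj y).A ≫ (M.obj y).a =
      (M.obj x).a ≫ M.mapA φ := (M.map φ).h

lemma appA_naturality {M N : Module U} (f : M ⟶ N) {x y : Q} (φ : x ⟶ y) :
    appA f x ≫ N.mapA φ = M.mapA φ ≫ appA f y :=
  congrArg Monad.Algebra.Hom.f (Hom.naturality f φ)

lemma appA_a {M N : Module U} (f : M ⟶ N) (x : Q) :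
    (U.obj x).map (appA f x) ≫ (N.obj x).a = (M.obj x).a ≫ appA f x := (Hom.app f x).h

lemma hom_ext_appA {M N : Module U} {f g : M ⟶ N} (h : ∀ x, appA f x = appA g x) : f = g :=
  hom_ext fun x => Monad.Algebra.Hom.ext (h x)

variable (U) in
/-- Evaluation of modules at a vertex. -/
@[simps]
def evaluation (x : Q) : Module U ⥤ (U.obj x).Algebra where
  obj M := M.obj x
  map f := Hom.app f x

section Colimits

variable {J : Type*} [Category J] (F : J ⥤ Module U)

/-- The morphism of `C` underlying a leg of a cocone of algebras. -/
def legA {F : J ⥤ Module U} {x : Q} (c : Cocone (F ⋙ evaluation U x)) (j : J) :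
    ((F.obj j).obj x).A ⟶ c.pt.A :=
  (c.ι.app j).f

variable {F} in
lemma appA_legA {x : Q} (c : Cocone (F ⋙ evaluation U x)) {i j : J} (f : i ⟶ j) :
    appA (F.map f) x ≫ legA c j = legA c i :=
  congrArg Monad.Algebra.Hom.f (c.w f)

/-- The cocone over the algebras at `x` with point `φ_* (c y).pt`. -/
@[simps]
def transitionCocone (c : ∀ x, Cocone (F ⋙ evaluation U x)) {x y : Q} (φ : x ⟶ y) :
    Cocone (F ⋙ evaluation U x) where
  pt := (restrict (U.map φ)).obj (c y).pt
  ι :=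
    { app := fun j => (F.obj j).map φ ≫ (restrict (U.map φ)).map ((c y).ι.app j)
      naturality := fun i j f => by
        apply Monad.Algebra.Hom.ext
        change appA (F.map f) x ≫ (F.obj j).mapA φ ≫ legA (c y) j =
          ((F.obj i).mapA φ ≫ legA (c y) i) ≫ 𝟙 (c y).pt.A
        rw [reassoc_of% appA_naturality, appA_legA, Category.comp_id] }

variable {F} {c : ∀ x, Cocone (F ⋙ evaluation U x)} (hc : ∀ x, IsColimit (c x))

/-- The transition morphisms between the given colimits. -/
def transition {x y : Q} (φ : x ⟶ y) : (c x).pt.A ⟶ (c y).pt.A :=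
  ((hc x).desc (transitionCocone F c φ)).f

lemma legA_transition {x y : Q} (φ : x ⟶ y) (j : J) :
    legA (c x) j ≫ transition hc φ = (F.obj j).mapA φ ≫ legA (c y) j :=
  congrArg Monad.Algebra.Hom.f ((hc x).fac (transitionCocone F c φ) j)

/-- The morphism from the given colimit at a vertex to another cocone. -/
def vertexDesc (s : Cocone F) (x : Q) : (c x).pt.A ⟶ (s.pt.obj x).A :=
  ((hc x).desc ((evaluation U x).mapCocone s)).f

lemma legA_vertexDesc (s : Cocone F) (x : Q) (j : J) :
    legA (c x) j ≫ vertexDesc hc s x = appA (s.ι.app j) x :=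
  congrArg Monad.Algebra.Hom.f ((hc x).fac ((evaluation U x).mapCocone s) j)

variable [∀ x, PreservesColimit (F ⋙ evaluation U x) (U.obj x).forget]

-- The forgetful functor preserves the colimit, so the legs are jointly epic in `C`, even against
-- morphisms that are not algebra maps.
include hc in
lemma legA_hom_ext {x : Q} {Z : C} {f g : (c x).pt.A ⟶ Z}
    (h : ∀ j, legA (c x) j ≫ f = legA (c x) j ≫ g) : f = g :=
  (isColimitOfPreserves (U.obj x).forget (hc x)).hom_ext h

lemma transition_id (x : Q) : transition hc (𝟙 x) = 𝟙 (c x).pt.A :=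
  legA_hom_ext hc fun j => by
    rw [legA_transition, mapA_id, Category.id_comp, Category.comp_id]

lemma transition_comp {x y z : Q} (φ : x ⟶ y) (ψ : y ⟶ z) :
    transition hc (φ ≫ ψ) = transition hc φ ≫ transition hc ψ :=
  legA_hom_ext hc fun j => by
    rw [legA_transition, reassoc_of% legA_transition, legA_transition, mapA_comp, Category.assoc]

lemma vertexDesc_naturality (s : Cocone F) {x y : Q} (φ : x ⟶ y) :
    vertexDesc hc s x ≫ s.pt.mapA φ = transition hc φ ≫ vertexDesc hc s y :=
  legA_hom_ext hc fun j => by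
    rw [reassoc_of% legA_vertexDesc, reassoc_of% legA_transition, legA_vertexDesc]
    exact appA_naturality (s.ι.app j) φ

/-- The cocone in the category of modules with given colimit cocones at the vertices. -/
@[simps]
def cocone : Cocone F where
  pt :=
    { obj := fun x => (c x).pt
      map := fun φ => (hc _).desc (transitionCocone F c φ)
      map_id := transition_id hc
      map_comp := transition_comp hc }
  ι :=
    { app := fun j =>
        { app := fun x => (c x).ι.app j
          naturality := fun φ => (hc _).fac (transitionCocone F c φ) j }
      naturality := fun _ _ f => hom_ext fun x => (c x).ι.naturality f }

/-- The cocone in the category of modules with given colimit cocones at the vertices is a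
colimit. -/
def coconeIsColimit : IsColimit (cocone hc) where
  desc s :=
    { app := fun x => (hc x).desc ((evaluation U x).mapCocone s)
      naturality := fun φ => Monad.Algebra.Hom.ext (vertexDesc_naturality hc s φ) }
  fac s j := hom_ext fun x => (hc x).fac ((evaluation U x).mapCocone s) j
  uniq s _ hm := hom_ext fun x => (hc x).uniq ((evaluation U x).mapCocone s) _
    fun j => congrArg (fun f => Hom.app f x) (hm j)

end Colimits

section

variable (J : Type*) [Category J] [HasColimitsOfShape J C]
  [∀ x, PreservesColimitsOfShape J (U.obj x).toFunctor]

instance hasColimitsOfShape_algebra (x : Q) : HasColimitsOfShape J (U.obj x).Algebra :=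
  ⟨fun D => Monad.forget_creates_colimits_of_monad_preserves D⟩

instance : HasColimitsOfShape J (Module U) :=
  ⟨fun F => ⟨⟨⟨_, coconeIsColimit fun x => colimit.isColimit (F ⋙ evaluation U x)⟩⟩⟩⟩

instance (x : Q) : PreservesColimitsOfShape J (evaluation U x) where
  preservesColimit {F} := preservesColimit_of_preserves_colimit_cocone
    (coconeIsColimit fun x => colimit.isColimit (F ⋙ evaluation U x))
    (colimit.isColimit (F ⋙ evaluation U x))

end

end Module

end Evaluation

/-! ### Cartesian modules are closed under colimits -/

lemma extendRestrictAdjunction_homEquiv {C : Type u} [Category.{v} C] [HasCoequalizers C]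
    {T T' : Monad C} [PreservesColimitsOfShape WalkingParallelPair T'.toFunctor] (φ : T ⟶ T')
    (M : T.Algebra) (N : T'.Algebra) :
    (extendRestrictAdjunction φ).homEquiv M N = extendHomEquiv φ M N :=
  congrFun (congrFun (Adjunction.mkOfHomEquiv_homEquiv _) M) N

section Cartesian

variable {C : Type u} [Category.{v} C] {Q : Type w} [Category.{w'} Q] {U : Q ⥤ Monad C}
  [HasCoequalizers C] [∀ x, PreservesColimitsOfShape WalkingParallelPair (U.obj x).toFunctor]

namespace Module

lemma extMap_naturality {M N : Module U} (f : M ⟶ N) {x y : Q} (φ : x ⟶ y) :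
    M.extMap φ ≫ Hom.app f y = (extend (U.map φ)).map (Hom.app f x) ≫ N.extMap φ := by
  have h := Hom.naturality f φ
  unfold extMap
  rw [← Adjunction.homEquiv_naturality_right_symm, ← Adjunction.homEquiv_naturality_left_symm, h]

variable (U) in
/-- The morphisms `M^φ` as a natural transformation. -/
@[simps]
noncomputable def extMapNatTrans {x y : Q} (φ : x ⟶ y) :
    evaluation U x ⋙ extend (U.map φ) ⟶ evaluation U y where
  app M := M.extMap φ
  naturality _ _ f := (extMap_naturality f φ).symm

lemma extMap_eq (M : Module U) {x y : Q} (φ : x ⟶ y) :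
    M.extMap φ = ofRestrict (U.map φ) (M.map φ) := 
  congrArg (fun e => e.symm (M.map φ)) (extendRestrictAdjunction_homEquiv (U.map φ) _ _)

lemma extendπ_extMap_f (M : Module U) {x y : Q} (φ : x ⟶ y) :
    (extendπ (U.map φ) (M.obj x) ≫ M.extMap φ).f =
      (U.obj y).map (M.mapA φ) ≫ (M.obj y).a := by
  rw [extMap_eq]
  exact extendπ_ofRestrict_f (U.map φ) (M.map φ)

end Module

section

variable (J : Type*) [Category J] [HasColimitsOfShape J C]
  [∀ x, PreservesColimitsOfShape J (U.obj x).toFunctor]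

/-- Evaluation at `x` followed by `φ^*`, and evaluation at `y`, both preserve colimits; so `M^φ` is
the map of colimits induced by the isomorphisms `D_j^φ`. -/
instance : (isCartesian U).IsClosedUnderColimitsOfShape J where
  colimitsOfShape_le := by
    rintro M ⟨⟨D, h⟩⟩ x y φ
    have : (extend (U.map φ)).IsLeftAdjoint := (extendRestrictAdjunction (U.map φ)).isLeftAdjoint
    have h1 := isColimitOfPreserves (Module.evaluation U x ⋙ extend (U.map φ)) D.isColimit
    have h2 := isColimitOfPreserves (Module.evaluation U y) D.isColimit
    let α := Functor.whiskerLeft D.diag (Module.extMapNatTrans U φ)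
    have (j : J) : IsIso (α.app j) := h j φ
    have : IsIso α := NatIso.isIso_of_isIso_app α
    let e := IsColimit.coconePointsIsoOfNatIso h1 h2 (asIso α)
    have he : M.extMap φ = e.hom := h1.hom_ext fun j =>
      ((Module.extMapNatTrans U φ).naturality (D.ι.app j)).trans
        (IsColimit.comp_coconePointsIsoOfNatIso_hom h1 h2 (asIso α) j).symm
    exact he ▸ e.isIso_hom

end

end Cartesian

/-! ### Co-well-poweredness of cartesian modules -/

section Epimorphisms

variable {C : Type u} [Category.{v} C] {Q : Type w} [Category.{w'} Q] {U : Q ⥤ Monad C}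

namespace Module

/-- Factor a morphism of modules through an epimorphism, given factorizations of the underlying
morphisms of `C`. -/
def factorEpi {M N P : Module U} (e : M ⟶ N) (f : M ⟶ P) [he : ∀ x, Epi (appA e x)]
    [∀ x, (U.obj x).toFunctor.PreservesEpimorphisms]
    (k : ∀ x, (N.obj x).A ⟶ (P.obj x).A) (hk : ∀ x, appA e x ≫ k x = appA f x) : N ⟶ P where
  app x :=
    { f := k x
      h := by
        rw [← cancel_epi ((U.obj x).map (appA e x)), ← Functor.map_comp_assoc, hk, appA_a,
          reassoc_of% (appA_a e x), hk] }
  naturality {x y} φ := by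
    apply Monad.Algebra.Hom.ext
    change k x ≫ P.mapA φ = N.mapA φ ≫ k y
    rw [← cancel_epi (appA e x), reassoc_of% (hk x), appA_naturality, reassoc_of% appA_naturality, hk]

lemma comp_factorEpi {M N P : Module U} (e : M ⟶ N) (f : M ⟶ P) [∀ x, Epi (appA e x)]
    [∀ x, (U.obj x).toFunctor.PreservesEpimorphisms]
    (k : ∀ x, (N.obj x).A ⟶ (P.obj x).A) (hk : ∀ x, appA e x ≫ k x = appA f x) :
    e ≫ factorEpi e f k hk = f :=
  hom_ext_appA hk

end Module

variable [HasColimitsOfShape WalkingParallelPair C] [HasColimitsOfShape WalkingSpan C]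
  [∀ x, PreservesColimitsOfShape WalkingParallelPair (U.obj x).toFunctor]
  [∀ x, PreservesColimitsOfShape WalkingSpan (U.obj x).toFunctor]

variable (U) in
/-- The functor sending a cartesian module to the object of `C` underlying its component at `x`. -/
abbrev cartForget (x : Q) : Cart U ⥤ C :=
  cartInclusion U ⋙ Module.evaluation U x ⋙ (U.obj x).forget

instance (x : Q) : PreservesColimitsOfShape WalkingSpan (cartForget U x) := by
  have : PreservesColimitsOfShape WalkingSpan (cartInclusion U) := inferInstance
  infer_instance

/-- Being an epimorphism is a pushout condition, and pushouts of cartesian modules are computed in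
`C`. -/
instance (x : Q) : (cartForget U x).PreservesEpimorphisms where
  preserves f := preserves_epi_of_preservesColimit (cartForget U x) f

open Opposite

variable (U) in
/-- The family of quotients of underlying objects given by a quotient of a cartesian module. -/
noncomputable def quotientFamily (N : Cart U) (s : Subobject (op N)) (x : Q) :
    Subobject (op ((cartForget U x).obj N)) :=
  Subobject.mk ((cartForget U x).map s.arrow.unop).op

/-- Comparison maps chosen in `C` at each vertex are automatically linear and compatible with
transitions, since these identities can be cancelled against epimorphisms. -/
lemma le_of_quotientFamily_le {N : Cart U} {s t : Subobject (op N)}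
    (h : quotientFamily U N s ≤ quotientFamily U N t) : s ≤ t := by
  let e : N ⟶ ((t : (Cart U)ᵒᵖ)).unop := t.arrow.unop
  let f : N ⟶ ((s : (Cart U)ᵒᵖ)).unop := s.arrow.unop
  have (x : Q) : Epi (Module.appA e.hom x) :=
    inferInstanceAs (Epi ((cartForget U x).map t.arrow.unop))
  have (x : Q) : (U.obj x).toFunctor.PreservesEpimorphisms :=
    ⟨fun f => preserves_epi_of_preservesColimit (U.obj x).toFunctor f⟩
  let k (x : Q) : (cartForget U x).obj ((t : (Cart U)ᵒᵖ)).unop ⟶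
      (cartForget U x).obj ((s : (Cart U)ᵒᵖ)).unop :=
    (Subobject.ofMkLEMk ((cartForget U x).map s.arrow.unop).op
      ((cartForget U x).map t.arrow.unop).op (h x)).unop
  have hk (x : Q) : Module.appA e.hom x ≫ k x = Module.appA f.hom x :=
    congrArg Quiver.Hom.unop (Subobject.ofMkLEMk_comp (h x))
  let q : ((t : (Cart U)ᵒᵖ)).unop ⟶ ((s : (Cart U)ᵒᵖ)).unop :=
    ObjectProperty.homMk (Module.factorEpi e.hom f.hom k hk)
  have hq : e ≫ q = f := by
    ext1
    exact Module.comp_factorEpi e.hom f.hom k hk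
  exact Subobject.le_of_comm q.op (congrArg Quiver.Hom.op hq)

end Epimorphisms

instance wellPowered_cart_op {C : Type u} [Category.{v} C] {Q : Type v} [Category.{v} Q]
    {U : Q ⥤ Monad C} [HasColimits C] [WellPowered.{v} Cᵒᵖ]
    [∀ x, PreservesColimits (U.obj x).toFunctor] : WellPowered.{v} (Cart U)ᵒᵖ where
  subobject_small N :=
    small_of_injective (f := quotientFamily U N.unop) fun _ _ h =>
      le_antisymm (le_of_quotientFamily_le h.le) (le_of_quotientFamily_le h.ge)

/-! ### Transport of subobjects in a Grothendieck category -/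

section Subobjects

variable {C : Type u} [Category.{v} C] [Abelian C]

/-- Turns factorization into a vanishing condition, which can be tested on epimorphisms, coproducts
and separators. -/
lemma factors_iff_comp_cokernel {A B : C} (R : Subobject B) (k : A ⟶ B) :
    R.Factors k ↔ k ≫ cokernel.π R.arrow = 0 := by
  constructor
  · intro h
    rw [← R.factorThru_arrow k h, Category.assoc, cokernel.condition, comp_zero]
  · intro h
    have hl : Abelian.monoLift R.arrow k h ≫ R.arrow = k := Abelian.monoLift_comp _ _ _
    rw [← hl]
    exact Subobject.factors_comp_arrow _

lemma factors_epi_comp_iff {A' A B : C} (R : Subobject B) (e : A' ⟶ A) [Epi e] (k : A ⟶ B) :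
    R.Factors (e ≫ k) ↔ R.Factors k := by
  rw [factors_iff_comp_cokernel, factors_iff_comp_cokernel, Category.assoc,
    ← cancel_epi e (g := k ≫ _), comp_zero]

lemma factors_of_isSeparator {G : C} (hG : IsSeparator G) {A B : C} (R : Subobject B) (k : A ⟶ B)
    (h : ∀ g : G ⟶ A, R.Factors (g ≫ k)) : R.Factors k := by
  rw [factors_iff_comp_cokernel]
  refine (isSeparator_def G).1 hG _ _ fun g => ?_
  rw [← Category.assoc, (factors_iff_comp_cokernel R (g ≫ k)).1 (h g), comp_zero]

lemma imageSubobject_le_iff {A B : C} (f : A ⟶ B) (R : Subobject B) :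
    imageSubobject f ≤ R ↔ R.Factors f := by
  constructor
  · intro h
    exact Subobject.factors_of_le f h (by simpa using imageSubobject_factors_comp_self f (𝟙 A))
  · intro h
    exact imageSubobject_le f (R.factorThru f h) (by simp)

/-- The image of a subobject `S` of `A` under `T S ⟶ T A ⟶ B`. -/
noncomputable def transport (T : C ⥤ C) {A B : C} (h : T.obj A ⟶ B) (S : Subobject A) :
    Subobject B :=
  imageSubobject (T.map S.arrow ≫ h)

section

variable (T : C ⥤ C) {A B : C} (h : T.obj A ⟶ B)

lemma transport_le_iff (S : Subobject A) (R : Subobject B) :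
    transport T h S ≤ R ↔ R.Factors (T.map S.arrow ≫ h) :=
  imageSubobject_le_iff _ _

lemma factors_transport_of_factors {X : C} (f : X ⟶ A) (S : Subobject A) (hf : S.Factors f) :
    (transport T h S).Factors (T.map f ≫ h) := by
  rw [← S.factorThru_arrow f hf, Functor.map_comp, Category.assoc]
  exact Subobject.factors_of_factors_right _ ((transport_le_iff T h S _).1 le_rfl)

lemma transport_mono : Monotone (transport T h) := fun S S' hS => by
  rw [transport_le_iff]
  exact factors_transport_of_factors T h _ _ (Subobject.factors_of_le _ hS S.factors_self)

lemma transport_imageSubobject_le_iff [T.PreservesEpimorphisms] {X : C} (f : X ⟶ A)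
    (R : Subobject B) : transport T h (imageSubobject f) ≤ R ↔ R.Factors (T.map f ≫ h) := by
  rw [transport_le_iff, ← factors_epi_comp_iff R (T.map (factorThruImageSubobject f)),
    ← Functor.map_comp_assoc, imageSubobject_arrow_comp]

lemma transport_top [Epi h] : transport T h ⊤ = ⊤ := by
  rw [eq_top_iff]
  refine Subobject.le_of_factors ?_
  have : (transport T h ⊤).Factors (T.map (⊤ : Subobject A).arrow ≫ h ≫ 𝟙 B) := by
    rw [Category.comp_id]
    exact (transport_le_iff T h ⊤ _).1 le_rfl
  rw [factors_epi_comp_iff, factors_epi_comp_iff] at this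
  simpa using Subobject.factors_of_factors_right (⊤ : Subobject B).arrow this

end

variable [IsGrothendieckAbelian.{v} C]

/-- The image of `∐ S i ⟶ A` is the supremum, so this map is, up to isomorphism, the projection onto
an image. -/
lemma epi_desc_iSup {A : C} {ι : Type v} (S : ι → Subobject A) :
    Epi (Sigma.desc fun i => Subobject.ofLE (S i) (⨆ i, S i) (le_iSup S i)) := by
  set d := Sigma.desc fun i => Subobject.ofLE (S i) (⨆ i, S i) (le_iSup S i) with hd
  have hd' (i : ι) : Sigma.ι (fun i => (S i : C)) i ≫ d ≫ (⨆ i, S i).arrow = (S i).arrow := by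
    rw [hd, Sigma.ι_desc_assoc, Subobject.ofLE_arrow]
  have h : imageSubobject (d ≫ (⨆ i, S i).arrow) = ⨆ i, S i := by
    apply le_antisymm
    · exact (imageSubobject_le_iff _ _).2 (Subobject.factors_comp_arrow _)
    · refine iSup_le fun i => Subobject.le_of_factors ?_
      rw [← hd' i]
      exact imageSubobject_factors_comp_self _ _
  have h' : d = factorThruImageSubobject (d ≫ (⨆ i, S i).arrow) ≫
      (Subobject.isoOfEq _ _ h).hom := by
    rw [← cancel_mono (⨆ i, S i).arrow, Category.assoc]
    simp
  rw [h']
  infer_instance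

/-- `T` preserves the epimorphism from `∐ S i` onto the supremum and the coproduct itself, so
factorization can be tested on each `T (S i)`. -/
lemma transport_iSup_le (T : C ⥤ C) [PreservesColimits T] {A B : C} (h : T.obj A ⟶ B)
    {ι : Type v} (S : ι → Subobject A) : transport T h (⨆ i, S i) ≤ ⨆ i, transport T h (S i) := by
  have := epi_desc_iSup S
  rw [transport_le_iff, ← factors_epi_comp_iff _ (T.map (Sigma.desc fun i =>
    Subobject.ofLE (S i) (⨆ i, S i) (le_iSup S i))), factors_iff_comp_cokernel]
  refine (isColimitOfPreserves T (coproductIsCoproduct fun i => (S i : C))).hom_ext ?_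
  rintro ⟨i⟩
  rw [comp_zero]
  have h1 : T.map (Sigma.ι (fun i => (S i : C)) i) ≫ T.map (Sigma.desc fun i =>
      Subobject.ofLE (S i) (⨆ i, S i) (le_iSup S i)) ≫ T.map (⨆ i, S i).arrow ≫ h =
      T.map (S i).arrow ≫ h := by
    rw [← Functor.map_comp_assoc, ← Functor.map_comp_assoc, Sigma.ι_desc,
      Subobject.ofLE_arrow]
  have h2 : (⨆ i, transport T h (S i)).Factors (T.map (S i).arrow ≫ h) :=
    (transport_le_iff _ _ _ _).1 (le_iSup (fun i => transport T h (S i)) i)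
  rw [factors_iff_comp_cokernel, ← h1] at h2
  simpa using h2

/-- The preimages of the `D j` under `g` exhaust `G`, as filtered colimits are exact. There are
fewer than `κ` distinct ones, so a single index dominates them all. -/
lemma exists_factors_of_iSup_eq_top {J : Type v} [Preorder J] {κ : Cardinal.{v}}
    [Fact κ.IsRegular] [IsCardinalFiltered J κ] {A G : C} (hG : HasCardinalLT (Subobject G) κ)
    (D : J → Subobject A) (hD : Monotone D) (h : ⨆ j, D j = ⊤) (g : G ⟶ A) :
    ∃ j, (D j).Factors g := by
  have := isFiltered_of_isCardinalFiltered J κ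
  let F : J ⥤ MonoOver A := hD.functor ⋙ Subobject.representative
  let c : Cocone (F ⋙ MonoOver.forget A) :=
    { pt := Over.mk (𝟙 A)
      ι :=
        { app := fun j => Over.homMk (D j).arrow (Category.comp_id _)
          naturality := fun i j f => Over.OverMorphism.ext
            ((Over.w ((MonoOver.forget A).map (F.map f))).trans (Category.comp_id _).symm) } }
  have : Mono c.pt.hom := inferInstanceAs (Mono (𝟙 A))
  have hc := IsGrothendieckAbelian.isColimitMapCoconeOfSubobjectMkEqISup F c (by
    refine Eq.trans (b := ⊤) rfl ?_
    rw [← h]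
    exact iSup_congr fun j => (Subobject.mk_arrow (D j)).symm)
  have (i j : J) (f : i ⟶ j) : Mono (((F ⋙ MonoOver.forget A) ⋙ Over.forget A).map f) := by
    have h : ((F ⋙ MonoOver.forget A) ⋙ Over.forget A).map f ≫ (D j).arrow = (D i).arrow :=
      Over.w ((MonoOver.forget A).map (F.map f))
    have h' : Mono (D i).arrow := Subobject.arrow_mono _
    rw [← h] at h'
    exact @mono_of_mono _ _ _ _ _ _ (D j).arrow h'
  obtain ⟨j, y, hy⟩ := IsGrothendieckAbelian.IsPresentable.surjectivity hc hG g
  exact ⟨j, hy ▸ Subobject.factors_comp_arrow _⟩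

end Subobjects

/-! ### Closing a family under transition maps -/

section ClosedFamilies

variable {Q : Type v} [Category.{v} Q] {L : Q → Type w} [∀ x, CompleteLattice (L x)]

/-- In a family of complete lattices with monotone transition maps, a family of small elements is
contained in a family of small elements which is preserved by the transition maps. -/
lemma exists_transition_eq (small : ∀ x, L x → Prop) (κ : Cardinal.{v}) [Fact κ.IsRegular]
    (from_lt : ∀ x : Q, HasCardinalLT (Σ y, x ⟶ y) κ)
    (to_lt : ∀ x : Q, HasCardinalLT (Σ w, w ⟶ x) κ)
    (hκ : HasCardinalLT ℕ κ)
    (small_iSup : ∀ (x : Q) {ι : Type v} (S : ι → L x), HasCardinalLT ι κ →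
      (∀ i, small x (S i)) → small x (⨆ i, S i))
    (F : ∀ {x y : Q}, (x ⟶ y) → L x → L y) (F_mono : ∀ {x y : Q} (φ : x ⟶ y), Monotone (F φ))
    (F_iSup : ∀ {x y : Q} (φ : x ⟶ y) {ι : Type v} (S : ι → L x), F φ (⨆ i, S i) ≤ ⨆ i, F φ (S i))
    (F_small : ∀ {x y : Q} (φ : x ⟶ y) (S : L x), small x S → small y (F φ S))
    (F_lift : ∀ {x y : Q} (φ : x ⟶ y) (R : L y), small y R → ∃ S, small x S ∧ R ≤ F φ S)
    (S₀ : ∀ x, L x) (hS₀ : ∀ x, small x (S₀ x)) :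
    ∃ S : ∀ x, L x, (∀ x, small x (S x)) ∧ S₀ ≤ S ∧
      ∀ {x y : Q} (φ : x ⟶ y), F φ (S x) = S y := by
  -- `lift` is meaningful only on small elements, so smallness must be carried through the
  -- iteration.
  choose! lift lift_small le_lift using @F_lift
  have small_sup (x : Q) (S T : L x) (hS : small x S) (hT : small x T) : small x (S ⊔ T) := by
    have : S ⊔ T = ⨆ b : ULift.{v} Bool, cond b.down S T := by
      rw [sup_eq_iSup, ← Equiv.ulift.{v}.iSup_congr (fun _ => rfl)]
      rfl
    rw [this]
    refine small_iSup x _ (hasCardinalLT_of_finite _ _ (Fact.out : κ.IsRegular).aleph0_le) ?_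
    rintro ⟨_ | _⟩ <;> assumption
  -- Add the images along arrows into `x` and, for each arrow out of `x`, a small element whose
  -- image covers the target. The sequences `F φ (seq n x)` and `seq n y` then interleave, so their
  -- suprema agree.
  let step (S : ∀ x, L x) (x : Q) : L x :=
    S x ⊔ ((⨆ p : Σ w, w ⟶ x, F p.2 (S p.1)) ⊔ ⨆ p : Σ y, x ⟶ y, lift p.2 (S p.1))
  let seq (n : ℕ) : ∀ x, L x := step^[n] S₀
  have seq_succ (n : ℕ) : seq (n + 1) = step (seq n) := Function.iterate_succ_apply' _ _ _
  have seq_small (n : ℕ) (x : Q) : small x (seq n x) := by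
    induction n generalizing x with
    | zero => exact hS₀ x
    | succ n ih =>
      rw [seq_succ]
      refine small_sup _ _ _ (ih x) (small_sup _ _ _ ?_ ?_)
      · exact small_iSup x _ (to_lt x) fun p => F_small _ _ (ih _)
      · exact small_iSup x _ (from_lt x) fun p => lift_small _ _ (ih _)
  have le_seq (n : ℕ) {x y : Q} (φ : x ⟶ y) : F φ (seq n x) ≤ seq (n + 1) y := by
    rw [seq_succ]
    exact ((le_iSup (fun p : Σ w, w ⟶ y => F p.2 (seq n p.1)) ⟨x, φ⟩).trans le_sup_left).trans
      le_sup_right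
  have seq_le (n : ℕ) {x y : Q} (φ : x ⟶ y) : seq n y ≤ F φ (seq (n + 1) x) := by
    refine (le_lift φ _ (seq_small n y)).trans (F_mono φ ?_)
    rw [seq_succ]
    exact ((le_iSup (fun p : Σ y, x ⟶ y => lift p.2 (seq n p.1)) ⟨y, φ⟩).trans
      le_sup_right).trans le_sup_right
  refine ⟨fun x => ⨆ n : ULift.{v} ℕ, seq n.down x, fun x => small_iSup x _ ?_ fun n =>
    seq_small _ x, fun x => le_iSup (fun n : ULift.{v} ℕ => seq n.down x) ⟨0⟩, fun φ => ?_⟩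
  · simpa using hκ
  · apply le_antisymm
    · refine (F_iSup φ _).trans (iSup_le fun n => (le_seq _ φ).trans ?_)
      exact le_iSup (fun n : ULift.{v} ℕ => seq n.down _) ⟨n.down + 1⟩
    · refine iSup_le fun n => (seq_le _ φ).trans (F_mono φ ?_)
      exact le_iSup (fun n : ULift.{v} ℕ => seq n.down _) ⟨n.down + 1⟩

end ClosedFamilies

/-! ### Subobjects with fewer than `κ` generators -/

section Generated

variable {C : Type u} [Category.{v} C] [Abelian C] [IsGrothendieckAbelian.{v} C]

/-- The subobject generated by a set of morphisms. -/
noncomputable def generated {G A : C} (s : Set (G ⟶ A)) : Subobject A :=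
  ⨆ g : s, imageSubobject g.1

lemma generated_le_iff {G A : C} (s : Set (G ⟶ A)) (R : Subobject A) :
    generated s ≤ R ↔ ∀ g ∈ s, R.Factors g := by
  simp [generated, imageSubobject_le_iff]

lemma factors_generated {G A : C} {s : Set (G ⟶ A)} {g : G ⟶ A} (hg : g ∈ s) :
    (generated s).Factors g :=
  (generated_le_iff s _).1 le_rfl g hg

lemma generated_mono {G A : C} : Monotone (generated (G := G) (A := A)) := fun _ _ h =>
  (generated_le_iff _ _).2 fun _ hg => factors_generated (h hg)

lemma generated_iUnion {G A : C} {ι : Type*} (s : ι → Set (G ⟶ A)) :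
    generated (⋃ i, s i) = ⨆ i, generated (s i) := by
  apply le_antisymm
  · rw [generated_le_iff]
    intro g hg
    obtain ⟨i, hi⟩ := Set.mem_iUnion.1 hg
    exact Subobject.factors_of_le _ (le_iSup _ i) (factors_generated hi)
  · exact iSup_le fun i => generated_mono (Set.subset_iUnion s i)

/-- A subobject is `κ`-small if it is generated by less than `κ` morphisms from `G`. -/
def IsSmallSubobject (G : C) (κ : Cardinal.{v}) {A : C} (S : Subobject A) : Prop :=
  ∃ s : Set (G ⟶ A), HasCardinalLT s κ ∧ S = generated s

variable {G : C} {κ : Cardinal.{v}} [Fact κ.IsRegular]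

lemma isSmallSubobject_iSup {A : C} {ι : Type v} (S : ι → Subobject A) (hι : HasCardinalLT ι κ)
    (hS : ∀ i, IsSmallSubobject G κ (S i)) : IsSmallSubobject G κ (⨆ i, S i) := by
  choose s hs hs' using hS
  exact ⟨⋃ i, s i, hasCardinalLT_iUnion s hι hs, by
    rw [generated_iUnion]
    exact iSup_congr hs'⟩

variable (T : C ⥤ C) [PreservesColimits T] {A B : C} (h : T.obj A ⟶ B)

lemma transport_generated_le_iff (s : Set (G ⟶ A)) (R : Subobject B) :
    transport T h (generated s) ≤ R ↔ ∀ g ∈ s, R.Factors (T.map g ≫ h) := by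
  constructor
  · intro hR g hg
    exact Subobject.factors_of_le _ hR (factors_transport_of_factors T h g _ (factors_generated hg))
  · intro hR
    have : T.PreservesEpimorphisms := ⟨fun f => preserves_epi_of_preservesColimit T f⟩
    refine (transport_iSup_le T h _).trans (iSup_le fun g => ?_)
    exact (transport_imageSubobject_le_iff T h g.1 R).2 (hR g.1 g.2)

/-- As `G` separates, the transport is generated by the composites `t ≫ T g ≫ h` with `t : G ⟶ T G`
and `g` a generator. -/
lemma isSmallSubobject_transport (hG : IsSeparator G) (hT : HasCardinalLT (G ⟶ T.obj G) κ)
    (S : Subobject A) (hS : IsSmallSubobject G κ S) : IsSmallSubobject G κ (transport T h S) := by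
  obtain ⟨s, hs, rfl⟩ := hS
  refine ⟨Set.range fun p : s × (G ⟶ T.obj G) => p.2 ≫ T.map p.1.1 ≫ h,
    (hasCardinalLT_prod (Fact.out : κ.IsRegular).aleph0_le hs hT).of_surjective _
      Set.rangeFactorization_surjective, le_antisymm ?_ ?_⟩
  · rw [transport_generated_le_iff]
    intro g hg
    exact factors_of_isSeparator hG _ _ fun t => factors_generated ⟨⟨⟨g, hg⟩, t⟩, rfl⟩
  · rw [generated_le_iff]
    rintro _ ⟨⟨g, t⟩, rfl⟩
    exact Subobject.factors_of_factors_right _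
      (factors_transport_of_factors T h _ _ (factors_generated g.2))

/-- `A` is the `κ`-directed union of its `κ`-small subobjects; since `h` is epi, their transports
cover `B`, and `g` already lands in one. -/
lemma exists_isSmallSubobject_factors_transport (hG : IsSeparator G)
    (hκ : HasCardinalLT (Subobject G) κ) [Epi h] (g : G ⟶ B) :
    ∃ S : Subobject A, IsSmallSubobject G κ S ∧ (transport T h S).Factors g := by
  let J := { s : Set (G ⟶ A) // HasCardinalLT s κ }
  have : IsCardinalFiltered J κ := isCardinalFiltered_preorder _ _ fun K s hK =>
    ⟨⟨⋃ k, (s k).1, hasCardinalLT_iUnion _ ((hasCardinalLT_iff_cardinal_mk_lt _ _).2 hK)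
      fun k => (s k).2⟩, fun k => Set.subset_iUnion (fun k => (s k).1) k⟩
  have hJ : ⨆ s : J, generated s.1 = ⊤ := by
    rw [eq_top_iff]
    refine Subobject.le_of_factors (factors_of_isSeparator hG _ _ fun g => ?_)
    refine Subobject.factors_of_le _ (le_iSup (fun s : J => generated s.1)
      ⟨{g ≫ (⊤ : Subobject A).arrow}, hasCardinalLT_of_finite _ _
        (Fact.out : κ.IsRegular).aleph0_le⟩) (factors_generated rfl)
  obtain ⟨s, hs⟩ := exists_factors_of_iSup_eq_top hκ (fun s : J => transport T h (generated s.1))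
    (fun s t hst => transport_mono T h (generated_mono hst)) (by
      rw [eq_top_iff, ← transport_top T h, ← hJ]
      exact transport_iSup_le T h _) g
  exact ⟨_, ⟨s.1, s.2, rfl⟩, hs⟩

lemma exists_isSmallSubobject_le_transport (hG : IsSeparator G)
    (hκ : HasCardinalLT (Subobject G) κ) [Epi h] (R : Subobject B) (hR : IsSmallSubobject G κ R) :
    ∃ S : Subobject A, IsSmallSubobject G κ S ∧ R ≤ transport T h S := by
  obtain ⟨s, hs, rfl⟩ := hR
  choose S hS hS' using fun g : G ⟶ B => exists_isSmallSubobject_factors_transport T h hG hκ g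
  refine ⟨⨆ g : s, S g, isSmallSubobject_iSup _ hs fun g => hS g, ?_⟩
  rw [generated_le_iff]
  intro g hg
  exact Subobject.factors_of_le _ (transport_mono T h (le_iSup (fun g : s => S g) ⟨g, hg⟩)) (hS' g)

omit [Fact κ.IsRegular] in
lemma imageSubobject_desc_eq_generated {A : C} {ι : Type v} (g : ι → (G ⟶ A)) :
    imageSubobject (Sigma.desc g) = generated (Set.range g) := by
  apply le_antisymm
  · rw [imageSubobject_le_iff, factors_iff_comp_cokernel]
    refine Sigma.hom_ext _ _ fun i => ?_
    rw [Sigma.ι_desc_assoc, comp_zero, ← factors_iff_comp_cokernel]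
    exact factors_generated ⟨i, rfl⟩
  · rw [generated_le_iff]
    rintro _ ⟨i, rfl⟩
    rw [← Sigma.ι_desc g i]
    exact imageSubobject_factors_comp_self _ _

variable (G κ) in
omit [Fact κ.IsRegular] in
/-- Every `κ`-small subobject is isomorphic to a member of a small family of objects. -/
lemma exists_representatives : ∃ (ι : Type v) (X : ι → C), ∀ (A : C) (S : Subobject A),
    IsSmallSubobject G κ S → ∃ i, Nonempty (X i ≅ (S : C)) := by
  -- A `κ`-small subobject is a quotient of a coproduct of copies of `G` indexed by a subset of `κ`,
  -- and each such coproduct has a small set of quotients.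
  let P (t : Set κ.out) : C := ∐ fun _ : t => G
  refine ⟨Σ t : Set κ.out, Shrink.{v} (Subobject (Opposite.op (P t))),
    fun i => ((equivShrink (Subobject (Opposite.op (P i.1)))).symm i.2 : Cᵒᵖ).unop, ?_⟩
  rintro A S ⟨s, hs, rfl⟩
  obtain ⟨f⟩ : Nonempty (s ↪ κ.out) := by
    rw [← Cardinal.le_def, Cardinal.mk_out]
    exact ((hasCardinalLT_iff_cardinal_mk_lt _ _).1 hs).le
  let e := Equiv.ofInjective f f.injective
  let g (k : Set.range f) : G ⟶ A := (e.symm k).1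
  have hg : Set.range g = s := by
    ext x
    exact ⟨fun ⟨k, hk⟩ => hk ▸ (e.symm k).2, fun hx => ⟨e ⟨x, hx⟩, by simp [g]⟩⟩
  rw [← hg, ← imageSubobject_desc_eq_generated]
  let q := factorThruImageSubobject (Sigma.desc g)
  refine ⟨⟨Set.range f, equivShrink _ (Subobject.mk q.op)⟩, ⟨?_⟩⟩
  exact eqToIso (congrArg (fun R : Subobject (Opposite.op (P (Set.range f))) =>
    (R : Cᵒᵖ).unop) (Equiv.symm_apply_apply _ _)) ≪≫ (Subobject.underlyingIso q.op).symm.unop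

end Generated

/-! ### Module structures on families of subobjects -/

section Submodules

lemma η_map_a {C : Type u} [Category.{v} C] {T : Monad C} (N : T.Algebra) {X : C} (j : X ⟶ N.A) :
    T.η.app X ≫ T.map j ≫ N.a = j := by
  have h : j ≫ T.η.app N.A = T.η.app X ≫ T.map j := Monad.unit_naturality _ T j
  rw [← reassoc_of% h, N.unit]
  exact Category.comp_id _

instance mono_f {C : Type u} [Category.{v} C] {T : Monad C} {M N : T.Algebra} (f : M ⟶ N)
    [Mono f] : Mono f.f :=
  inferInstanceAs (Mono (T.forget.map f))

variable {C : Type u} [Category.{v} C] {Q : Type w} [Category.{w'} Q] (U : Q ⥤ Monad C)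

/-- A module structure on a family of objects of `C`. -/
structure ModuleData (X : Q → C) where
  /-- the algebra structures -/
  a (x : Q) : (U.obj x).obj (X x) ⟶ X x
  /-- the transition morphisms -/
  m {x y : Q} (φ : x ⟶ y) : X x ⟶ X y
  unit (x : Q) : (U.obj x).η.app (X x) ≫ a x = 𝟙 (X x)
  assoc (x : Q) : (U.obj x).μ.app (X x) ≫ a x = (U.obj x).map (a x) ≫ a x
  m_a {x y : Q} (φ : x ⟶ y) :
    (U.obj x).map (m φ) ≫ (U.map φ).app (X y) ≫ a y = a x ≫ m φ
  m_id (x : Q) : m (𝟙 x) = 𝟙 (X x)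
  m_comp {x y z : Q} (φ : x ⟶ y) (ψ : y ⟶ z) : m (φ ≫ ψ) = m φ ≫ m ψ

variable {U} {X : Q → C}

namespace ModuleData

/-- The module given by a module structure on a family of objects. -/
@[simps]
def toModule (D : ModuleData U X) : Module U where
  obj x := { A := X x, a := D.a x, unit := D.unit x, assoc := D.assoc x }
  map φ := { f := D.m φ, h := D.m_a φ }
  map_id := D.m_id
  map_comp := D.m_comp

variable {N : Module U} (j : ∀ x, X x ⟶ (N.obj x).A) [∀ x, Mono (j x)]
  (a : ∀ x, (U.obj x).obj (X x) ⟶ X x) (ha : ∀ x, a x ≫ j x = (U.obj x).map (j x) ≫ (N.obj x).a)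
  (m : ∀ {x y : Q}, (x ⟶ y) → (X x ⟶ X y))
  (hm : ∀ {x y : Q} (φ : x ⟶ y), m φ ≫ j y = j x ≫ N.mapA φ)

/-- The module structure on a family of subobjects of a module. -/
@[simps]
def ofMono : ModuleData U X where
  a := a
  m := m
  unit x := by
    rw [← cancel_mono (j x), Category.assoc, ha, η_map_a]
    exact (Category.id_comp _).symm
  assoc x := by
    rw [← cancel_mono (j x), Category.assoc, Category.assoc, ha, ← Functor.map_comp_assoc, ha,
      Functor.map_comp_assoc, ← (N.obj x).assoc,
      reassoc_of% (Monad.mu_naturality _ (U.obj x) (j x))]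
  m_a {x y} φ := by
    have h : (U.obj x).map (j y) ≫ (U.map φ).app (N.obj y).A =
        (U.map φ).app (X y) ≫ (U.obj y).map (j y) := (U.map φ).toNatTrans.naturality (j y)
    rw [← cancel_mono (j y), Category.assoc, Category.assoc, Category.assoc, ha, hm,
      ← reassoc_of% h, ← Functor.map_comp_assoc, hm, reassoc_of% (ha x), Functor.map_comp_assoc,
      Module.mapA_a]
  m_id x := by
    rw [← cancel_mono (j x), hm, Module.mapA_id, Category.id_comp, Category.comp_id]
  m_comp {x y z} φ ψ := by
    rw [← cancel_mono (j z), hm, Module.mapA_comp, Category.assoc, hm, reassoc_of% (hm φ)]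

/-- The inclusion of a family of subobjects as a morphism of modules. -/
@[simps]
def ofMonoHom : (ofMono j a ha m hm).toModule ⟶ N where
  app x := { f := j x, h := (ha x).symm }
  naturality φ := Monad.Algebra.Hom.ext (hm φ).symm

end ModuleData

/-- The structure morphism `T_y N_x ⟶ N_y` of a module, for `φ : x ⟶ y`. -/
def Module.act (N : Module U) {x y : Q} (φ : x ⟶ y) :
    (U.obj y).obj (N.obj x).A ⟶ (N.obj y).A :=
  (U.obj y).map (N.mapA φ) ≫ (N.obj y).a

lemma Module.map_act (N : Module U) {x y : Q} (φ : x ⟶ y) {Y : C} (k : Y ⟶ (N.obj x).A) :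
    (U.obj y).map k ≫ N.act φ = (U.obj y).map (k ≫ N.mapA φ) ≫ (N.obj y).a := by
  rw [act, Functor.map_comp_assoc]

/-- Lets stability under `act` along identities express closure under the algebra structure. -/
lemma Module.act_id (N : Module U) (x : Q) : N.act (𝟙 x) = (N.obj x).a := by
  rw [act, mapA_id]
  exact (congrArg (· ≫ (N.obj x).a) ((U.obj x).toFunctor.map_id _)).trans (Category.id_comp _)

end Submodules

/-! ### Cartesian submodules -/

section Cartesian

variable {C : Type u} [Category.{v} C] [Abelian C] {Q : Type w} [Category.{w'} Q]
  {U : Q ⥤ Monad C} [∀ x, PreservesColimitsOfShape WalkingParallelPair (U.obj x).toFunctor]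
  [∀ x, PreservesColimitsOfShape WalkingSpan (U.obj x).toFunctor]

instance (x : Q) : (U.obj x).forget.PreservesEpimorphisms where
  preserves f := preserves_epi_of_preservesColimit (U.obj x).forget f

instance {x y : Q} (φ : x ⟶ y) (M : (U.obj x).Algebra) : Epi (extendπ (U.map φ) M) :=
  inferInstanceAs (Epi (coequalizer.π (extendTop (U.map φ) M) (extendBot (U.obj y) M)))

instance epi_f {x : Q} {M N : (U.obj x).Algebra} (f : M ⟶ N) [Epi f] : Epi f.f :=
  inferInstanceAs (Epi ((U.obj x).forget.map f))

/-- The action is the coequalizer projection followed by the isomorphism `N^φ`. -/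
lemma epi_act {N : Module U} (hN : isCartesian U N) {x y : Q} (φ : x ⟶ y) : Epi (N.act φ) := by
  rw [Module.act, ← Module.extendπ_extMap_f]
  let g : extendObj (U.map φ) (N.obj x) ⟶ N.obj y := N.extMap φ
  have : IsIso g := hN φ
  exact inferInstanceAs (Epi (extendπ (U.map φ) (N.obj x) ≫ g).f)

omit [∀ x, PreservesColimitsOfShape WalkingSpan (U.obj x).toFunctor] in
/-- A submodule of a cartesian module over a flat monad quiver is cartesian if the structure
morphisms `T_y M_x ⟶ M_y` are epimorphisms. -/
lemma isCartesian_of_mono (hU : IsFlat U) {M N : Module U} (hN : isCartesian U N) (f : M ⟶ N)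
    [∀ x, Mono (Module.appA f x)] (hM : ∀ {x y : Q} (φ : x ⟶ y), Epi (M.act φ)) :
    isCartesian U M := by
  intro x y φ
  have := hN φ
  have hmono (x : Q) : Mono (Module.Hom.app f x) :=
    (U.obj x).forget.mono_of_mono_map (inferInstanceAs (Mono (Module.appA f x)))
  -- Flatness enters here: `φ^*` preserves the monomorphism `f_x`, so `M^φ ≫ f_y = φ^* f_x ≫ N^φ` is
  -- mono.
  have := ((exactFunctor_iff _).1 (hU φ)).1
  have h := Module.extMap_naturality f φ
  have h1 : Mono (M.extMap φ ≫ Module.Hom.app f y) := by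
    rw [h]
    infer_instance
  have h2 : Mono (M.extMap φ) := mono_of_mono _ (Module.Hom.app f y)
  let g : extendObj (U.map φ) (M.obj x) ⟶ M.obj y := M.extMap φ
  have h3 : Mono g.f := @mono_f _ _ _ _ _ g h2
  have h4 : Epi ((extendπ (U.map φ) (M.obj x)).f ≫ g.f) := by
    have h := Module.extendπ_extMap_f M φ
    have := hM φ
    rw [Module.act, ← h] at this
    exact this
  have h5 : Epi g.f := epi_of_epi (extendπ (U.map φ) (M.obj x)).f _
  have : IsIso g.f := isIso_of_mono_of_epi _
  exact Monad.algebra_iso_of_iso _ g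

/-- A family of subobjects of a cartesian module stable under transport underlies a cartesian
submodule. -/
lemma exists_submodule (hU : IsFlat U) {N : Module U} (hN : isCartesian U N)
    (S : ∀ x, Subobject (N.obj x).A)
    (hS : ∀ {x y : Q} (φ : x ⟶ y), transport (U.obj y).toFunctor (N.act φ) (S x) = S y)
    {X : Q → C} (i : ∀ x, X x ≅ (S x : C)) :
    ∃ (D : ModuleData U X) (f : D.toModule ⟶ N), isCartesian U D.toModule ∧
      ∀ x, Module.appA f x = (i x).hom ≫ (S x).arrow := by
  let j (x : Q) : X x ⟶ (N.obj x).A := (i x).hom ≫ (S x).arrow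
  have exists_epi {x y : Q} (φ : x ⟶ y) : ∃ e : (U.obj y).obj (X x) ⟶ X y,
      Epi e ∧ e ≫ j y = (U.obj y).map (j x) ≫ N.act φ := by
    let t := (U.obj y).map (S x).arrow ≫ N.act φ
    have ht : imageSubobject t = S y := hS φ
    refine ⟨(U.obj y).map (i x).hom ≫ factorThruImageSubobject t ≫
      (Subobject.isoOfEq _ _ ht).hom ≫ (i y).inv, inferInstance, ?_⟩
    have h : (Subobject.isoOfEq _ _ ht).hom ≫ (S y).arrow = (imageSubobject t).arrow := by simp
    rw [Category.assoc, Category.assoc, Category.assoc, Iso.inv_hom_id_assoc, h,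
      imageSubobject_arrow_comp, ← Functor.map_comp_assoc]
  choose e he hej using @exists_epi
  have ha (x : Q) : e (𝟙 x) ≫ j x = (U.obj x).map (j x) ≫ (N.obj x).a := by
    rw [hej, Module.act_id]
  -- Precomposing the action with the unit recovers the transition map of `N`, so `e` also supplies
  -- the transitions of the submodule.
  have hm {x y : Q} (φ : x ⟶ y) : ((U.obj y).η.app (X x) ≫ e φ) ≫ j y = j x ≫ N.mapA φ := by
    rw [Category.assoc, hej, Module.map_act, η_map_a]
  have (x : Q) : Mono (j x) := mono_comp _ _
  let D := ModuleData.ofMono j (fun x => e (𝟙 x)) ha (fun φ => _ ≫ e φ) hm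
  let f : D.toModule ⟶ N := ModuleData.ofMonoHom j (fun x => e (𝟙 x)) ha (fun φ => _ ≫ e φ) hm
  have (x : Q) : Mono (Module.appA f x) := inferInstanceAs (Mono (j x))
  refine ⟨D, f, isCartesian_of_mono hU hN f fun {x y} φ => ?_, fun x => rfl⟩
  have h : D.toModule.act φ = e φ := by
    change (U.obj y).map ((U.obj y).η.app (X x) ≫ e φ) ≫ e (𝟙 y) = e φ
    rw [← cancel_mono (j y), Category.assoc, ha, ← Functor.map_comp_assoc, hm,
      hej, Module.map_act]
  rw [h]
  exact he φ

end Cartesian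

/-! ### A small separating family -/

section Separating

variable {C : Type u} [Category.{v} C] [Abelian C] [IsGrothendieckAbelian.{v} C]
  {Q : Type v} [Category.{v} Q] {U : Q ⥤ Monad C} [∀ x, PreservesColimits (U.obj x).toFunctor]

/-- The cartesian modules over a flat monad quiver have a small separating family. -/
lemma exists_small_isSeparating (hU : IsFlat U) :
    ∃ P : ObjectProperty (Cart U), ObjectProperty.Small.{v} P ∧ P.IsSeparating := by
  let G := separator C
  have hG : IsSeparator G := isSeparator_separator C
  -- `κ` must exceed `ℕ` (the iteration), the subobjects of `G` (lifting), the arrows of `Q`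
  -- (suprema in each step) and all `G ⟶ U_x G` (transport).
  obtain ⟨κ, hκ, h⟩ := HasCardinalLT.exists_regular_cardinal.{v}
    ((ℕ ⊕ Subobject G) ⊕ ((Σ x y : Q, x ⟶ y) ⊕ Σ x, (G ⟶ (U.obj x).obj G)))
  have : Fact κ.IsRegular := ⟨hκ⟩
  rw [hasCardinalLT_sum_iff _ _ _ hκ.aleph0_le, hasCardinalLT_sum_iff _ _ _ hκ.aleph0_le,
    hasCardinalLT_sum_iff _ _ _ hκ.aleph0_le] at h
  obtain ⟨⟨hℕ, hSub⟩, hQ, hT⟩ := h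
  have hT' (y : Q) : HasCardinalLT (G ⟶ (U.obj y).obj G) κ :=
    hT.of_injective (fun t => ⟨y, t⟩) fun t t' h => by simpa using h
  obtain ⟨ι, X, hX⟩ := exists_representatives G κ
  let I := Σ c : Q → ι, { D : ModuleData U (X ∘ c) // isCartesian U D.toModule }
  let Z (p : I) : Cart U := ⟨p.2.1.toModule, p.2.2⟩
  refine ⟨ObjectProperty.ofObj Z, inferInstance, fun N N' f g hfg => ?_⟩
  ext1
  refine Module.hom_ext_appA fun x => hG.def _ _ fun γ => ?_
  have (x y : Q) (φ : x ⟶ y) : Epi (N.obj.act φ) := epi_act N.property φ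
  obtain ⟨S, hS, hS₀, hSt⟩ := exists_transition_eq (L := fun x => Subobject (N.obj.obj x).A)
    (fun x => IsSmallSubobject G κ) κ
    (fun x => hQ.of_injective (fun p => ⟨x, p⟩) fun p p' h => by simpa using h)
    (fun x => hQ.of_injective (fun p => ⟨p.1, x, p.2⟩) (by
      rintro ⟨w, φ⟩ ⟨w', φ'⟩ h
      aesop))
    hℕ (fun x _ S hι hS => isSmallSubobject_iSup S hι hS)
    (fun {x y} φ => transport (U.obj y).toFunctor (N.obj.act φ))
    (fun φ => transport_mono _ _) (fun φ _ S => transport_iSup_le _ _ S)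
    (fun {x y} φ S hS => isSmallSubobject_transport _ _ hG (hT' y) S hS)
    (fun φ R hR => exists_isSmallSubobject_le_transport _ _ hG hSub R hR)
    -- The initial family is generated by `γ` at `x` and by the empty set elsewhere.
    (fun y => generated {k | ∃ h : x = y, k = γ ≫ eqToHom (by rw [h])})
    (fun y => ⟨_, @hasCardinalLT_of_finite _ (Set.Subsingleton.finite (by
      rintro _ ⟨rfl, rfl⟩ _ ⟨_, rfl⟩
      rfl)) _ hκ.aleph0_le, rfl⟩)
  choose c i using fun x => hX _ (S x) (hS x)
  obtain ⟨D, j, hD, hj⟩ := exists_submodule hU N.property S hSt (X := X ∘ c)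
    (fun x => (i x).some)
  have hγ : (S x).Factors γ :=
    Subobject.factors_of_le _ (hS₀ x) (factors_generated ⟨rfl, by simp⟩)
  let p : I := ⟨c, D, hD⟩
  have hp := hfg (Z p) ⟨p⟩ (ObjectProperty.homMk j)
  have hp' : Module.appA j x ≫ Module.appA f.hom x = Module.appA j x ≫ Module.appA g.hom x :=
    congrArg (fun k : Z p ⟶ N' => Module.appA k.hom x) hp
  obtain ⟨e, he⟩ : ∃ e : (S x : C) ⟶ (D.toModule.obj x).A, e ≫ Module.appA j x = (S x).arrow :=
    ⟨(i x).some.inv, by rw [hj]; exact Iso.inv_hom_id_assoc _ _⟩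
  rw [← (S x).factorThru_arrow γ hγ, ← he, Category.assoc, Category.assoc, Category.assoc,
    Category.assoc, hp']

end Separating

end MonadQuiver

theorem mainTheorem2 {C : Type u} [Category.{v} C] [Abelian C] [IsGrothendieckAbelian.{v} C]
    (hG : ∃ G : C, IsSeparator G ∧ Projective G)
    {Q : Type v} [PartialOrder Q] (U : Q ⥤ Monad C)
    [∀ x : Q, PreservesFiniteLimits (U.obj x).toFunctor]
    [∀ x : Q, PreservesColimits (U.obj x).toFunctor]
    (hU : MonadQuiver.IsFlat U) :
    (MonadQuiver.cartInclusion U).IsLeftAdjoint := by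
  obtain ⟨P, _, hP⟩ := MonadQuiver.exists_small_isSeparating hU
  have : HasColimits (MonadQuiver.Cart U) := ⟨fun J _ => inferInstance⟩
  have : PreservesColimits (MonadQuiver.cartInclusion U) := ⟨fun {J} _ => inferInstance⟩
  exact isLeftAdjoint_of_preservesColimits_of_isSeparating hP _
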